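/- All ordinals at which stationarity is considered are limit ordinals. For a limit ordinal $\kappa$ and sets of ordinals $S,C$, define by recursion on the ordinal $\gamma$: $S$ is $0$-stationary in $\kappa$ if $S\cap\kappa$ is unbounded in $\kappa$; for $\gamma>0$, $S$ is $\gamma$-stationary in $\kappa$ if for every $\eta<\gamma$, $\kappa$ is $\eta$-reflecting and $S\cap C\cap\kappa\neq\emptyset$ for every $C$ that is $\eta$-club in $\kappa$. Here $C$ is $\gamma$-club in $\kappa$ if $C$ is $\gamma$-stationary in $\kappa$ and every $\alpha<\kappa$ such that $C$ is $\gamma$-stationary in $\alpha$ belongs to $C$; and $\kappa$ is $\gamma$-reflecting if for all $A,B\subseteq\kappa$ that are $\gamma$-stationary in $\kappa$ there is $\alpha<\kappa$ such that $A$ and $B$ are both $\gamma$-stationary in $\alpha$. For $S\subseteq\kappa$ let $d_\gamma(S)=\{\alpha<\kappa : S\cap\alpha \text{ is } \gamma\text{-stationary in }\alpha\}$; for $S\subseteq\alpha<\kappa$ given as a subset of $\alpha$, $d_\gamma(S)$ is formed in $\alpha$, that is, it consists of ordinals $<\alpha$. The $\gamma$-club filter is $\mathcal C^\gamma(\kappa)=\{X\subseteq\kappa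 : X\text{ contains a }\gamma\text{-club of }\kappa\}$; it is normal if it is a (nonempty) filter on $\kappa$ that is closed under diagonal intersections $\triangle_{\alpha<\kappa}X_\alpha=\{\xi<\kappa:\xi\in X_\alpha\text{ for all }\alpha<\xi\}$. A $\Box^\gamma$-sequence on $\kappa$ is a sequence $\langle C_\alpha:\alpha\in d_\gamma(\kappa)\rangle$ such that for every $\alpha\in d_\gamma(\kappa)$, $C_\alpha\subseteq\alpha$ is $\gamma$-club in $\alpha$, and $C_\beta=C_\alpha\cap\beta$ for every $\beta\in d_\gamma(C_\alpha)$. A thread through it is a set $C\subseteq\kappa$ that is $\gamma$-club in $\kappa$ with $C_\alpha=C\cap\alpha$ for all $\alpha\in d_\gamma(C)$. The principle $\Box^\gamma(\kappa)$ says that some $\Box^\gamma$-sequence on $\kappa$ has no thread. Theorem. Let $\gamma$ be an ordinal and let $\kappa$ be a regular cardinal that is $\gamma$-reflecting and such that $\mathcal C^\gamma(\kappa)$ is normal. Let $S=\langle C_\alpha:\alpha\in d_\gamma(\kappa)\rangle$ be a $\Box^\gamma$-sequence on $\kappa$. Then the following are equivalent: (1) $S$ has no thread; (2) for every $T\subseteq\kappa$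 that is $(\gamma+1)$-stationary in $\kappa$ there are $S_0,S_1\subseteq T$, both $(\gamma+1)$-stationary in $\kappa$, such that for every $\alpha\in d_\gamma(\kappa)$, $d_\gamma(C_\alpha)\cap S_0=\emptyset$ or $d_\gamma(C_\alpha)\cap S_1=\emptyset$. Consequently, $\Box^\gamma(\kappa)$ implies that $\kappa$ is not $(\gamma+1)$-reflecting. -/

import Mathlib

universe u

namespace GenStat

open Set Order

/-- Given a notion `P S α` ("`S` is stationary in `α`"), the set `C` is closed below `κ`
with respect to `P`. -/
def ClosedBelowFor (P : Set Ordinal.{u} → Ordinal.{u} → Prop)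
    (C : Set Ordinal.{u}) (κ : Ordinal.{u}) : Prop :=
  ∀ α < κ, P C α → α ∈ C

/-- `C` is closed below `κ` and stationary in `κ` with respect to `P`. -/
def ClubFor (P : Set Ordinal.{u} → Ordinal.{u} → Prop)
    (C : Set Ordinal.{u}) (κ : Ordinal.{u}) : Prop :=
  ClosedBelowFor P C κ ∧ P C κ

/-- Any two subsets of `κ` that are stationary in `κ` with respect to `P` reflect
simultaneously to some `α < κ`. -/
def ReflectingFor (P : Set Ordinal.{u} → Ordinal.{u} → Prop) (κ : Ordinal.{u}) : Prop :=
  ∀ A B : Set Ordinal.{u}, A ⊆ Iio κ → B ⊆ Iio κ → P A κ → P B κ → ∃ α < κ, P A α ∧ P B α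

/-- `Stationary γ S κ`: the set of ordinals `S` is `γ`-stationary in `κ`, by recursion on `γ`.
For `γ = 0` this is unboundedness in `κ`; for `γ > 0` it says that, for every `η < γ`, `κ` is
`η`-reflecting and `S` meets (below `κ`) every `η`-club of `κ`. All notions are taken at limit
ordinals `κ` only. -/
def Stationary (γ : Ordinal.{u}) : Set Ordinal.{u} → Ordinal.{u} → Prop :=
  fun S κ =>
    IsSuccLimit κ ∧
    (γ = 0 → ∀ β < κ, ∃ s ∈ S, β < s ∧ s < κ) ∧
    ∀ η, (_h : η < γ) →
      ReflectingFor (Stationary η) κ ∧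
      ∀ C : Set Ordinal.{u}, ClubFor (Stationary η) C κ → ∃ x < κ, x ∈ S ∧ x ∈ C
termination_by γ

/-- `C` is `γ`-club in `κ`: it is `γ`-stationary-closed below `κ` and `γ`-stationary in `κ`. -/
def IsClub (γ : Ordinal.{u}) (C : Set Ordinal.{u}) (κ : Ordinal.{u}) : Prop :=
  ClubFor (Stationary γ) C κ

/-- `κ` is `γ`-reflecting. -/
def Reflecting (γ κ : Ordinal.{u}) : Prop :=
  ReflectingFor (Stationary γ) κ

/-- The `0`-stationary sets are the unbounded sets (at limit ordinals). -/
theorem stationary_zero_iff (S : Set Ordinal.{u}) (κ : Ordinal.{u}) :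
    Stationary 0 S κ ↔ IsSuccLimit κ ∧ ∀ β < κ, ∃ s ∈ S, β < s ∧ s < κ := by
  rw [Stationary]
  constructor
  · rintro ⟨h₁, h₂, -⟩
    exact ⟨h₁, h₂ rfl⟩
  · rintro ⟨h₁, h₂⟩
    exact ⟨h₁, fun _ => h₂, fun η h => absurd h (not_lt.2 zero_le)⟩

/-- The recursive clause for `γ > 0`. -/
theorem stationary_iff_of_pos {γ : Ordinal.{u}} (hγ : 0 < γ) (S : Set Ordinal.{u})
    (κ : Ordinal.{u}) :
    Stationary γ S κ ↔ IsSuccLimit κ ∧ ∀ η < γ, Reflecting η κ ∧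
      ∀ C : Set Ordinal.{u}, IsClub η C κ → ∃ x < κ, x ∈ S ∧ x ∈ C := by
  rw [Stationary]
  simp [hγ.ne', Reflecting, IsClub]

/-- `derived γ κ S` is `d_γ(S)` for a subset `S` of `κ`: the set of all `α < κ` such that
`S ∩ α` is `γ`-stationary in `α`. -/
def derived (γ κ : Ordinal.{u}) (S : Set Ordinal.{u}) : Set Ordinal.{u} :=
  {α | α < κ ∧ Stationary γ (S ∩ Iio α) α}

/-- The `γ`-club filter `𝒞^γ(κ)`: all subsets of `κ` that contain a `γ`-club of `κ`. -/
def clubFilter (γ κ : Ordinal.{u}) : Set (Set Ordinal.{u}) :=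
  {X | X ⊆ Iio κ ∧ ∃ C ⊆ X, IsClub γ C κ}

/-- The diagonal intersection of the sets `X α`, `α < κ`. -/
def diagInter (κ : Ordinal.{u}) (X : Ordinal.{u} → Set Ordinal.{u}) : Set Ordinal.{u} :=
  {ξ | ξ < κ ∧ ∀ α < ξ, ξ ∈ X α}

/-- Normality of the `γ`-club filter on `κ`: `κ` belongs to it and it is closed under diagonal
intersections. It is upward closed and does not contain `∅` by its definition, and closed under
finite intersections whenever `κ` is `γ`-reflecting, so those filter laws are not repeated. -/
def ClubFilterNormal (γ κ : Ordinal.{u}) : Prop :=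
  Iio κ ∈ clubFilter γ κ ∧
  ∀ X : Ordinal.{u} → Set Ordinal.{u},
    (∀ α < κ, X α ∈ clubFilter γ κ) → diagInter κ X ∈ clubFilter γ κ

/-- `⟨C α : α ∈ d_γ(κ)⟩` is a `□^γ`-sequence on `κ`. Only the values of `C` on `d_γ(κ)` matter. -/
def IsBoxSeq (γ κ : Ordinal.{u}) (C : Ordinal.{u} → Set Ordinal.{u}) : Prop :=
  ∀ α ∈ derived γ κ (Iio κ),
    (C α ⊆ Iio α ∧ IsClub γ (C α) α) ∧
    ∀ β ∈ derived γ α (C α), C β = C α ∩ Iio β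

/-- `D` is a thread through the sequence `C` on `κ`. -/
def IsThread (γ κ : Ordinal.{u}) (C : Ordinal.{u} → Set Ordinal.{u})
    (D : Set Ordinal.{u}) : Prop :=
  D ⊆ Iio κ ∧ IsClub γ D κ ∧ ∀ α ∈ derived γ κ D, C α = D ∩ Iio α

/-- The principle `□^γ(κ)`: some `□^γ`-sequence on `κ` has no thread. -/
def BoxPrinciple (γ κ : Ordinal.{u}) : Prop :=
  ∃ C : Ordinal.{u} → Set Ordinal.{u}, IsBoxSeq γ κ C ∧ ¬ ∃ D, IsThread γ κ C D

end GenStat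

/-!
`γ`-stationarity in `κ` means meeting every `η`-club of `κ` for `η < γ`. By simultaneous
reflection the `γ`-clubs of a `γ`-reflecting ordinal are closed under finite intersections and
under `d_γ`, and its `(γ+1)`-stationary sets are those that meet every `γ`-club.

Suppose that for every `α < κ` only one of the answers to `α ∈ C_β` occurs at
`(γ+1)`-stationarily many `β ∈ T`. The other answer is then avoided on a `γ`-club `E_α`, so by
normality `C_β = A ∩ β` for all `β ∈ T` in the diagonal intersection, where `A` is the set of `α`
with answer "yes", and `A` is a thread. Hence without a thread some `α` yields two
`(γ+1)`-stationary sets `{β ∈ T | α ∉ C_β}` and `{β ∈ T | α ∈ C_β}`; by coherence no `d_γ(C_δ)`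
can meet both of them above `α`. Conversely, `d_γ` of a thread is a `γ`-club, which meets any two
`(γ+1)`-stationary sets, and a long enough initial segment of it is some `d_γ(C_α)`. In the same
way, if both sets reflected to `α`, then both would meet the `γ`-club `d_γ(C_α)` of `α`.
-/

namespace GenStat

open Set Order

variable {α β γ η κ : Ordinal.{u}} {S S₀ S₁ T D E : Set Ordinal.{u}}

theorem IsClub.stationary (hE : IsClub γ E κ) : Stationary γ E κ :=
  hE.2

theorem IsClub.mem (hE : IsClub γ E κ) (hα : α < κ) (h : Stationary γ E α) : α ∈ E :=
  hE.1 α hα h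

theorem isClub_zero_Ioi (hκ : IsSuccLimit κ) (hβ : β < κ) : IsClub 0 (Ioi β) κ := by
  refine ⟨fun α _ h => ?_, (stationary_zero_iff _ _).2 ⟨hκ, fun δ hδ => ?_⟩⟩
  · obtain ⟨hα, h⟩ := (stationary_zero_iff _ _).1 h
    obtain ⟨s, hβs, -, hsα⟩ := h 0 hα.bot_lt
    exact lt_trans hβs hsα
  · have hmax : max β δ < succ (max β δ) := lt_succ _
    exact ⟨succ (max β δ), (le_max_left _ _).trans_lt hmax, (le_max_right _ _).trans_lt hmax,
      hκ.succ_lt (max_lt hβ hδ)⟩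

/-- The sets that test `γ`-stationarity in `κ`: the final segments of `κ` and its `η`-clubs for
`η < γ`. For `γ > 0` the final segments are among the `0`-clubs; admitting them for all `γ` makes
`stationary_iff` uniform in `γ`. -/
def IsLowerClub (γ : Ordinal.{u}) (E : Set Ordinal.{u}) (κ : Ordinal.{u}) : Prop :=
  (∃ β < κ, E = Ioi β) ∨ ∃ η < γ, IsClub η E κ

theorem isLowerClub_Ioi (hβ : β < κ) : IsLowerClub γ (Ioi β) κ :=
  .inl ⟨β, hβ, rfl⟩

theorem IsClub.isLowerClub (hE : IsClub η E κ) (hη : η < γ) : IsLowerClub γ E κ :=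
  .inr ⟨η, hη, hE⟩

theorem isLowerClub_zero_iff : IsLowerClub 0 E κ ↔ ∃ β < κ, E = Ioi β := by
  simp [IsLowerClub]

theorem isLowerClub_iff_of_pos (hγ : 0 < γ) (hκ : IsSuccLimit κ) :
    IsLowerClub γ E κ ↔ ∃ η < γ, IsClub η E κ := by
  refine or_iff_right_of_imp ?_
  rintro ⟨β, hβ, rfl⟩
  exact ⟨0, hγ, isClub_zero_Ioi hκ hβ⟩

theorem IsLowerClub.of_le (hE : IsLowerClub η E κ) (hη : η ≤ γ) : IsLowerClub γ E κ :=
  hE.imp_right fun ⟨ζ, hζ, hEζ⟩ => ⟨ζ, hζ.trans_le hη, hEζ⟩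

theorem stationary_iff : Stationary γ S κ ↔ IsSuccLimit κ ∧ (∀ η < γ, Reflecting η κ) ∧
    ∀ E, IsLowerClub γ E κ → ∃ x < κ, x ∈ S ∧ x ∈ E := by
  obtain rfl | hγ := eq_zero_or_pos γ
  · simp only [stationary_zero_iff, isLowerClub_zero_iff]
    refine and_congr_right fun _ => ⟨fun h => ⟨fun η hη => absurd hη not_lt_zero, ?_⟩, ?_⟩
    · rintro _ ⟨β, hβ, rfl⟩
      obtain ⟨s, hs, hβs, hsκ⟩ := h β hβ
      exact ⟨s, hsκ, hs, hβs⟩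
    · rintro ⟨-, h⟩ β hβ
      obtain ⟨s, hsκ, hs, hβs⟩ := h _ ⟨β, hβ, rfl⟩
      exact ⟨s, hs, hβs, hsκ⟩
  · rw [stationary_iff_of_pos hγ]
    refine and_congr_right fun hκ => ⟨fun h => ⟨fun η hη => (h η hη).1, fun E hE => ?_⟩,
      fun h η hη => ⟨h.1 η hη, fun E hE => h.2 E (hE.isLowerClub hη)⟩⟩
    obtain ⟨η, hη, hEη⟩ := (isLowerClub_iff_of_pos hγ hκ).1 hE
    exact (h η hη).2 E hEη

theorem Stationary.isSuccLimit (h : Stationary γ S κ) : IsSuccLimit κ :=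
  (stationary_iff.1 h).1

theorem Stationary.reflecting (h : Stationary γ S κ) (hη : η < γ) : Reflecting η κ :=
  (stationary_iff.1 h).2.1 η hη

theorem Stationary.meets (h : Stationary γ S κ) (hE : IsLowerClub γ E κ) :
    ∃ x < κ, x ∈ S ∧ x ∈ E :=
  (stationary_iff.1 h).2.2 E hE

theorem Stationary.mono (h : Stationary γ S κ) (hST : S ∩ Iio κ ⊆ T) : Stationary γ T κ := by
  refine stationary_iff.2 ⟨h.isSuccLimit, fun _ => h.reflecting, fun E hE => ?_⟩
  obtain ⟨x, hx, hxS, hxE⟩ := h.meets hE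
  exact ⟨x, hx, hST ⟨hxS, hx⟩, hxE⟩

theorem stationary_inter_Iio : Stationary γ (S ∩ Iio κ) κ ↔ Stationary γ S κ :=
  ⟨fun h => h.mono fun _ hx => hx.1.1, fun h => h.mono subset_rfl⟩

theorem Stationary.stationary_Iio (h : Stationary γ S κ) : Stationary γ (Iio κ) κ :=
  h.mono inter_subset_right

theorem Stationary.of_le (h : Stationary γ S κ) (hη : η ≤ γ) : Stationary η S κ :=
  stationary_iff.2 ⟨h.isSuccLimit, fun _ hζ => h.reflecting (hζ.trans_le hη),
    fun _ hE => h.meets (hE.of_le hη)⟩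

theorem Stationary.exists_gt (h : Stationary γ S κ) (hβ : β < κ) : ∃ s ∈ S, β < s ∧ s < κ := by
  obtain ⟨s, hsκ, hsS, hβs⟩ := h.meets (isLowerClub_Ioi hβ)
  exact ⟨s, hsS, hβs, hsκ⟩

theorem IsLowerClub.mem (hE : IsLowerClub γ E κ) (hα : α < κ) (h : Stationary γ E α) :
    α ∈ E := by
  obtain ⟨β, -, rfl⟩ | ⟨η, hη, hEη⟩ := hE
  · obtain ⟨s, hβs, -, hsα⟩ := h.exists_gt h.isSuccLimit.bot_lt
    exact lt_trans hβs hsα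
  · exact hEη.mem hα (h.of_le hη.le)

theorem Reflecting.exists_lt (hrefl : Reflecting γ κ) (hS : Stationary γ S κ)
    (hT : Stationary γ T κ) : ∃ α < κ, Stationary γ S α ∧ Stationary γ T α := by
  obtain ⟨α, hα, hSα, hTα⟩ := hrefl (S ∩ Iio κ) (T ∩ Iio κ) inter_subset_right inter_subset_right
    (stationary_inter_Iio.2 hS) (stationary_inter_Iio.2 hT)
  exact ⟨α, hα, hSα.mono fun _ hx => hx.1.1, hTα.mono fun _ hx => hx.1.1⟩

theorem Reflecting.stationary_setOf (hrefl : Reflecting γ κ)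
    (hS : ∀ E, IsLowerClub γ E κ → Stationary γ (S ∩ E) κ) (hT : Stationary γ T κ) :
    Stationary γ {α | Stationary γ S α ∧ Stationary γ T α} κ := by
  refine stationary_iff.2 ⟨hT.isSuccLimit, fun _ => hT.reflecting, fun E hE => ?_⟩
  obtain ⟨α, hα, hSEα, hTα⟩ := hrefl.exists_lt (hS E hE) hT
  exact ⟨α, hα, ⟨hSEα.mono fun _ hx => hx.1.1, hTα⟩, hE.mem hα (hSEα.mono fun _ hx => hx.1.2)⟩

theorem IsClub.of_le_of_stationary (hE : IsClub η E κ) (hη : η ≤ γ) (h : Stationary γ E κ) :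
    IsClub γ E κ :=
  ⟨fun _ hα hEα => hE.mem hα (hEα.of_le hη), h⟩

/-- Every `γ`-club `D` satisfies `hDinter` by `Stationary.inter_isLowerClub`, but the induction
proving that relies on this lemma at smaller `γ`. -/
theorem IsClub.inter_of_forall_stationary_inter (hrefl : Reflecting γ κ) (hD : IsClub γ D κ)
    (hDinter : ∀ F, IsLowerClub γ F κ → Stationary γ (D ∩ F) κ) (hE : IsClub γ E κ) :
    IsClub γ (D ∩ E) κ :=
  ⟨fun _ hα h => ⟨hD.mem hα (h.mono fun _ hx => hx.1.1), hE.mem hα (h.mono fun _ hx => hx.1.2)⟩,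
    (hrefl.stationary_setOf hDinter hE.stationary).mono fun _ ⟨⟨hDα, hEα⟩, hα⟩ =>
      ⟨hD.mem hα hDα, hE.mem hα hEα⟩⟩

theorem Stationary.inter_isLowerClub (hS : Stationary γ S κ) (hE : IsLowerClub γ E κ) :
    Stationary γ (S ∩ E) κ := by
  induction γ using WellFoundedLT.induction generalizing S E with
  | ind γ ih =>
    refine stationary_iff.2 ⟨hS.isSuccLimit, fun _ => hS.reflecting, fun F hF => ?_⟩
    suffices hEF : IsLowerClub γ (E ∩ F) κ by
      obtain ⟨x, hx, hxS, hxE, hxF⟩ := hS.meets hEF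
      exact ⟨x, hx, ⟨hxS, hxE⟩, hxF⟩
    obtain rfl | hγ := eq_zero_or_pos γ
    · obtain ⟨β, hβ, rfl⟩ := isLowerClub_zero_iff.1 hE
      obtain ⟨δ, hδ, rfl⟩ := isLowerClub_zero_iff.1 hF
      rw [Ioi_inter_Ioi]
      exact isLowerClub_Ioi (max_lt hβ hδ)
    · obtain ⟨η, hη, hEη⟩ := (isLowerClub_iff_of_pos hγ hS.isSuccLimit).1 hE
      obtain ⟨ξ, hξ, hFξ⟩ := (isLowerClub_iff_of_pos hγ hS.isSuccLimit).1 hF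
      have hμ : max η ξ < γ := max_lt hη hξ
      have isClub_max {ζ : Ordinal.{u}} {G : Set Ordinal.{u}} (hζ : ζ ≤ max η ξ)
          (hG : IsClub ζ G κ) : IsClub (max η ξ) G κ := by
        obtain rfl | hlt := hζ.eq_or_lt
        · exact hG
        · exact hG.of_le_of_stationary hζ <|
            (ih _ hμ (hS.of_le hμ.le) (hG.isLowerClub hlt)).mono fun _ hx => hx.1.2
      have hEμ := isClub_max (le_max_left _ _) hEη
      have hFμ := isClub_max (le_max_right _ _) hFξ
      exact (hEμ.inter_of_forall_stationary_inter (hS.reflecting hμ)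
        (fun _ => ih _ hμ hEμ.stationary) hFμ).isLowerClub hμ

theorem IsClub.of_le (hE : IsClub η E κ) (hη : η ≤ γ) (hκ : Stationary γ (Iio κ) κ) :
    IsClub γ E κ := by
  obtain rfl | hlt := hη.eq_or_lt
  · exact hE
  · exact hE.of_le_of_stationary hη <|
      (hκ.inter_isLowerClub (hE.isLowerClub hlt)).mono fun _ hx => hx.1.2

theorem isClub_Iio (h : Stationary γ (Iio κ) κ) : IsClub γ (Iio κ) κ :=
  ⟨fun _ hα _ => hα, h⟩

theorem IsClub.inter_Iio (hE : IsClub γ E κ) : IsClub γ (E ∩ Iio κ) κ :=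
  ⟨fun _ hα h => ⟨hE.mem hα (h.mono fun _ hx => hx.1.1), hα⟩,
    stationary_inter_Iio.2 hE.stationary⟩

theorem mem_derived : α ∈ derived γ κ S ↔ α < κ ∧ Stationary γ S α := by
  rw [← stationary_inter_Iio (S := S)]
  rfl

theorem derived_mono (h : S ⊆ T) : derived γ κ S ⊆ derived γ κ T := fun _ hα =>
  mem_derived.2 ⟨hα.1, (mem_derived.1 hα).2.mono fun _ hx => h hx.1⟩

theorem derived_inter_Iio (hα : α ≤ κ) :
    derived γ α (S ∩ Iio α) = derived γ κ S ∩ Iio α := by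
  ext β
  simp only [mem_inter_iff, mem_derived, mem_Iio]
  exact ⟨fun ⟨hβ, h⟩ => ⟨⟨hβ.trans_le hα, h.mono fun _ hx => hx.1.1⟩, hβ⟩,
    fun ⟨⟨_, h⟩, hβ⟩ => ⟨hβ, h.mono fun _ hx => ⟨hx.1, hx.2.trans hβ⟩⟩⟩

theorem IsClub.isClub_derived (hrefl : Reflecting γ κ) (hE : IsClub γ E κ) :
    IsClub γ (derived γ κ E) κ := by
  refine ⟨fun α hα h => mem_derived.2 ⟨hα, h.mono fun x hx => ?_⟩, ?_⟩
  · obtain ⟨hxκ, hEx⟩ := mem_derived.1 hx.1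
    exact hE.mem hxκ hEx
  · exact (hrefl.stationary_setOf (fun _ => hE.stationary.inter_isLowerClub) hE.stationary).mono
      fun _ ⟨⟨h, _⟩, hα⟩ => mem_derived.2 ⟨hα, h⟩

theorem Stationary.of_derived (h : Stationary γ (derived γ κ S) κ) : Stationary γ S κ := by
  refine stationary_iff.2 ⟨h.isSuccLimit, fun _ => h.reflecting, fun E hE => ?_⟩
  obtain ⟨β, hβκ, hSβ, hEβ⟩ : ∃ β < κ, Stationary γ S β ∧ IsLowerClub γ E β := by
    obtain ⟨δ, hδ, rfl⟩ | ⟨η, hη, hEη⟩ := hE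
    · obtain ⟨β, hβ, hδβ, hβκ⟩ := h.exists_gt hδ
      exact ⟨β, hβκ, (mem_derived.1 hβ).2, isLowerClub_Ioi hδβ⟩
    · obtain ⟨β, hβκ, hβ, hβE⟩ :=
        h.meets ((hEη.isClub_derived (h.reflecting hη)).isLowerClub hη)
      have hEβ : IsClub η E β := ⟨fun _ hα => hEη.mem (hα.trans hβκ), (mem_derived.1 hβE).2⟩
      exact ⟨β, hβκ, (mem_derived.1 hβ).2, hEβ.isLowerClub hη⟩
  obtain ⟨x, hx, hxS, hxE⟩ := hSβ.meets hEβ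
  exact ⟨x, hx.trans hβκ, hxS, hxE⟩

theorem IsClub.isLowerClub_add_one (hE : IsClub γ E κ) : IsLowerClub (γ + 1) E κ :=
  hE.isLowerClub (lt_add_one γ)

theorem stationary_add_one_iff (hrefl : Reflecting γ κ) (hκ : Stationary γ (Iio κ) κ) :
    Stationary (γ + 1) S κ ↔ ∀ E, IsClub γ E κ → ∃ x < κ, x ∈ S ∧ x ∈ E := by
  have hpos : 0 < γ + 1 := zero_le.trans_lt (lt_add_one γ)
  refine ⟨fun h E hE => h.meets hE.isLowerClub_add_one, fun h =>
    (stationary_iff_of_pos hpos _ _).2 ⟨hκ.isSuccLimit, fun η hη => ?_⟩⟩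
  have hηγ : η ≤ γ := lt_add_one_iff.1 hη
  refine ⟨?_, fun E hE => h E (hE.of_le hηγ hκ)⟩
  obtain rfl | hlt := hηγ.eq_or_lt
  · exact hrefl
  · exact hκ.reflecting hlt

theorem stationary_add_one_Iio (hrefl : Reflecting γ κ) (hκ : Stationary γ (Iio κ) κ) :
    Stationary (γ + 1) (Iio κ) κ := by
  refine (stationary_add_one_iff hrefl hκ).2 fun E hE => ?_
  obtain ⟨x, hxE, -, hxκ⟩ := hE.stationary.exists_gt hκ.isSuccLimit.bot_lt
  exact ⟨x, hxκ, hxκ, hxE⟩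

theorem exists_isClub_disjoint (hrefl : Reflecting γ κ) (hκ : Stationary γ (Iio κ) κ)
    (hS : ¬ Stationary (γ + 1) S κ) : ∃ E, IsClub γ E κ ∧ Disjoint E S := by
  rw [stationary_add_one_iff hrefl hκ] at hS
  push Not at hS
  obtain ⟨E, hE, hdisj⟩ := hS
  exact ⟨E ∩ Iio κ, hE.inter_Iio, disjoint_left.2 fun x hx hxS => hdisj x hx.2 hxS hx.1⟩

theorem Stationary.derived_inter_nonempty (hS : Stationary (γ + 1) S κ) (hE : IsClub γ E κ) :
    (derived γ κ E ∩ S).Nonempty := by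
  obtain ⟨x, -, hxS, hxE⟩ :=
    hS.meets (hE.isClub_derived (hS.reflecting (lt_add_one γ))).isLowerClub_add_one
  exact ⟨x, hxE, hxS⟩

theorem ClubFilterNormal.stationary_Iio (h : ClubFilterNormal γ κ) :
    Stationary γ (Iio κ) κ := by
  obtain ⟨-, E, -, hE⟩ := h.1
  exact hE.stationary.stationary_Iio

theorem ClubFilterNormal.exists_isClub_subset_diagInter (h : ClubFilterNormal γ κ)
    {E : Ordinal.{u} → Set Ordinal.{u}} (hE : ∀ α < κ, IsClub γ (E α) κ) :
    ∃ F ⊆ diagInter κ E, IsClub γ F κ := by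
  obtain ⟨-, F, hF, hFclub⟩ := h.2 (fun α => E α ∩ Iio κ) fun α hα =>
    ⟨inter_subset_right, _, subset_rfl, (hE α hα).inter_Iio⟩
  exact ⟨F, fun ξ hξ => ⟨(hF hξ).1, fun α hα => ((hF hξ).2 α hα).1⟩, hFclub⟩

variable {C : Ordinal.{u} → Set Ordinal.{u}}

theorem ClubFilterNormal.exists_isClub_forall_inter_Iio_eq (hnormal : ClubFilterNormal γ κ)
    (hrefl : Reflecting γ κ)
    (hC : ∀ α < κ, Stationary (γ + 1) {β ∈ T | α ∉ C β} κ →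
      ¬ Stationary (γ + 1) {β ∈ T | α ∈ C β} κ) :
    ∃ A ⊆ Iio κ, ∃ F, IsClub γ F κ ∧ ∀ β ∈ T ∩ F, C β ∩ Iio β = A ∩ Iio β := by
  have decided : ∀ α < κ, ∃ E, IsClub γ E κ ∧
      ((∀ β ∈ T ∩ E, α ∈ C β) ∨ ∀ β ∈ T ∩ E, α ∉ C β) := fun α hα => by
    by_cases hno : Stationary (γ + 1) {β ∈ T | α ∉ C β} κ
    · obtain ⟨E, hE, hdisj⟩ := exists_isClub_disjoint hrefl hnormal.stationary_Iio (hC α hα hno)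
      exact ⟨E, hE, .inr fun β hβ hαβ => disjoint_left.1 hdisj hβ.2 ⟨hβ.1, hαβ⟩⟩
    · obtain ⟨E, hE, hdisj⟩ := exists_isClub_disjoint hrefl hnormal.stationary_Iio hno
      exact ⟨E, hE, .inl fun β hβ =>
        by_contra fun hαβ => disjoint_left.1 hdisj hβ.2 ⟨hβ.1, hαβ⟩⟩
  choose! E hE hdecided using decided
  obtain ⟨F, hF, hFclub⟩ := hnormal.exists_isClub_subset_diagInter hE
  refine ⟨{α | α < κ ∧ ∀ β ∈ T ∩ E α, α ∈ C β}, fun α hα => hα.1, F, hFclub, fun β hβ => ?_⟩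
  obtain ⟨hβκ, hβE⟩ := hF hβ.2
  ext α
  refine and_congr_left fun hαβ => ⟨fun hα => ?_, fun hα => hα.2 β ⟨hβ.1, hβE α hαβ⟩⟩
  have hακ : α < κ := hαβ.trans hβκ
  exact ⟨hακ, (hdecided α hακ).resolve_right fun h => h β ⟨hβ.1, hβE α hαβ⟩ hα⟩

theorem IsBoxSeq.isThread_of_forall_eq {A : Set Ordinal.{u}} (hC : IsBoxSeq γ κ C)
    (hT : Stationary γ T κ) (hTκ : T ⊆ derived γ κ (Iio κ)) (hA : A ⊆ Iio κ)
    (h : ∀ β ∈ T, C β = A ∩ Iio β) : IsThread γ κ C A := by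
  have above : ∀ α < κ, Stationary γ A α → ∃ β ∈ T, α < β ∧ α ∈ derived γ β (C β) := by
    intro α hα hAα
    obtain ⟨β, hβ, hαβ, hβκ⟩ := hT.exists_gt hα
    refine ⟨β, hβ, hαβ, ?_⟩
    rw [h β hβ, derived_inter_Iio hβκ.le]
    exact ⟨mem_derived.2 ⟨hα, hAα⟩, hαβ⟩
  refine ⟨hA, ⟨fun α hα hAα => ?_, ?_⟩, fun α hα => ?_⟩
  · obtain ⟨β, hβ, hαβ, hαC⟩ := above α hα hAα
    have hmem : α ∈ C β := (hC β (hTκ hβ)).1.2.mem hαβ (mem_derived.1 hαC).2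
    rw [h β hβ] at hmem
    exact hmem.1
  · refine Stationary.of_derived (hT.mono fun β ⟨hβ, hβκ⟩ => mem_derived.2 ⟨hβκ, ?_⟩)
    exact (hC β (hTκ hβ)).1.2.stationary.mono fun x hx => ((h β hβ).subset hx.1).1
  · obtain ⟨hακ, hAα⟩ := mem_derived.1 hα
    obtain ⟨β, hβ, hαβ, hαC⟩ := above α hακ hAα
    rw [(hC β (hTκ hβ)).2 α hαC, h β hβ, inter_assoc, Iio_inter_Iio, min_eq_right hαβ.le]

theorem IsBoxSeq.exists_stationary_splitting (hC : IsBoxSeq γ κ C) (hrefl : Reflecting γ κ)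
    (hnormal : ClubFilterNormal γ κ) (hno : ¬ ∃ D, IsThread γ κ C D)
    (hT : Stationary (γ + 1) T κ) :
    ∃ α < κ, Stationary (γ + 1) {β ∈ T | α ∉ C β} κ ∧
      Stationary (γ + 1) {β ∈ T | α ∈ C β} κ := by
  by_contra! hsplit
  obtain ⟨A, hA, F, hF, hAF⟩ := hnormal.exists_isClub_forall_inter_Iio_eq hrefl hsplit
  have hd := (isClub_Iio hnormal.stationary_Iio).isClub_derived hrefl
  have hTF : Stationary (γ + 1) (T ∩ F ∩ derived γ κ (Iio κ)) κ :=
    (hT.inter_isLowerClub hF.isLowerClub_add_one).inter_isLowerClub hd.isLowerClub_add_one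
  refine hno ⟨A, hC.isThread_of_forall_eq (hTF.of_le (lt_add_one γ).le) inter_subset_right hA ?_⟩
  rintro β ⟨hβ, hβd⟩
  rw [← hAF β hβ, inter_eq_left.2 (hC β hβd).1.1]

/-- `C` separates `S₀` from `S₁`: no `d_γ(C_α)` meets both of them. This is the relation between
the two pieces in clause (2) of the theorem. -/
def Separates (γ κ : Ordinal.{u}) (C : Ordinal.{u} → Set Ordinal.{u})
    (S₀ S₁ : Set Ordinal.{u}) : Prop :=
  ∀ α ∈ derived γ κ (Iio κ), derived γ α (C α) ∩ S₀ = ∅ ∨ derived γ α (C α) ∩ S₁ = ∅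

theorem IsBoxSeq.separates (hC : IsBoxSeq γ κ C) (hS₀ : ∀ β ∈ S₀, α < β ∧ α ∉ C β)
    (hS₁ : ∀ β ∈ S₁, α ∈ C β) : Separates γ κ C S₀ S₁ := by
  intro δ hδ
  by_contra! hne
  obtain ⟨⟨β₀, hβ₀, hβ₀S⟩, β₁, hβ₁, hβ₁S⟩ := hne
  obtain ⟨hαβ₀, hα₀⟩ := hS₀ β₀ hβ₀S
  have hα₁ := hS₁ β₁ hβ₁S
  rw [(hC δ hδ).2 β₀ hβ₀] at hα₀
  rw [(hC δ hδ).2 β₁ hβ₁] at hα₁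
  exact hα₀ ⟨hα₁.1, hαβ₀⟩

theorem IsBoxSeq.exists_separates (hC : IsBoxSeq γ κ C) (hrefl : Reflecting γ κ)
    (hnormal : ClubFilterNormal γ κ) (hno : ¬ ∃ D, IsThread γ κ C D)
    (hT : Stationary (γ + 1) T κ) :
    ∃ S₀ ⊆ T, ∃ S₁ ⊆ T, Stationary (γ + 1) S₀ κ ∧ Stationary (γ + 1) S₁ κ ∧
      Separates γ κ C S₀ S₁ := by
  obtain ⟨α, hα, h₀, h₁⟩ := hC.exists_stationary_splitting hrefl hnormal hno hT
  exact ⟨{β ∈ T | α ∉ C β} ∩ Ioi α, fun _ hβ => hβ.1.1, {β ∈ T | α ∈ C β}, fun _ hβ => hβ.1,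
    h₀.inter_isLowerClub (isLowerClub_Ioi hα), h₁,
    hC.separates (fun _ hβ => ⟨hβ.2, hβ.1.2⟩) fun _ hβ => hβ.2⟩

theorem IsThread.not_separates (hD : IsThread γ κ C D) (h₀ : Stationary (γ + 1) S₀ κ)
    (h₁ : Stationary (γ + 1) S₁ κ) : ¬ Separates γ κ C S₀ S₁ := by
  obtain ⟨hDκ, hDclub, hthread⟩ := hD
  have hd := hDclub.isClub_derived (h₀.reflecting (lt_add_one γ))
  obtain ⟨β₀, hβ₀D, hβ₀S⟩ := h₀.derived_inter_nonempty hDclub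
  obtain ⟨β₁, hβ₁D, hβ₁S⟩ := h₁.derived_inter_nonempty hDclub
  obtain ⟨α, hα, hβα, hακ⟩ := hd.stationary.exists_gt (max_lt hβ₀D.1 hβ₁D.1)
  obtain ⟨hβ₀α, hβ₁α⟩ := max_lt_iff.1 hβα
  intro hsep
  have hdisj := hsep α (derived_mono hDκ hα)
  rw [hthread α hα, derived_inter_Iio hακ.le] at hdisj
  exact hdisj.elim (Nonempty.ne_empty ⟨β₀, ⟨hβ₀D, hβ₀α⟩, hβ₀S⟩)
    (Nonempty.ne_empty ⟨β₁, ⟨hβ₁D, hβ₁α⟩, hβ₁S⟩)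

theorem IsBoxSeq.not_stationary_of_separates (hC : IsBoxSeq γ κ C)
    (hsep : Separates γ κ C S₀ S₁) (hα : α < κ) (h₀ : Stationary (γ + 1) S₀ α) :
    ¬ Stationary (γ + 1) S₁ α := by
  intro h₁
  have hακ : α ∈ derived γ κ (Iio κ) :=
    mem_derived.2 ⟨hα, (h₀.of_le (lt_add_one γ).le).mono fun _ hx => hx.2.trans hα⟩
  have hCα : IsClub γ (C α) α := (hC α hακ).1.2
  exact (hsep α hακ).elim (h₀.derived_inter_nonempty hCα).ne_empty
    (h₁.derived_inter_nonempty hCα).ne_empty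

end GenStat

theorem mainTheorem7 (κ : Cardinal.{u}) (γ : Ordinal.{u}) (hκ : κ.IsRegular)
    (hrefl : GenStat.Reflecting γ κ.ord) (hnormal : GenStat.ClubFilterNormal γ κ.ord) :
    (∀ C : Ordinal.{u} → Set Ordinal.{u}, GenStat.IsBoxSeq γ κ.ord C →
      ((¬ ∃ D, GenStat.IsThread γ κ.ord C D) ↔
        ∀ T ⊆ Set.Iio κ.ord, GenStat.Stationary (γ + 1) T κ.ord →
          ∃ S₀ ⊆ T, ∃ S₁ ⊆ T,
            GenStat.Stationary (γ + 1) S₀ κ.ord ∧ GenStat.Stationary (γ + 1) S₁ κ.ord ∧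
            ∀ α ∈ GenStat.derived γ κ.ord (Set.Iio κ.ord),
              GenStat.derived γ α (C α) ∩ S₀ = ∅ ∨ GenStat.derived γ α (C α) ∩ S₁ = ∅)) ∧
    (GenStat.BoxPrinciple γ κ.ord → ¬ GenStat.Reflecting (γ + 1) κ.ord) := by
  have hκκ := GenStat.stationary_add_one_Iio hrefl hnormal.stationary_Iio
  refine ⟨fun C hC => ⟨fun hno T _ hT => hC.exists_separates hrefl hnormal hno hT, ?_⟩, ?_⟩
  · rintro hsplit ⟨D, hD⟩
    obtain ⟨S₀, -, S₁, -, h₀, h₁, hsep⟩ := hsplit _ subset_rfl hκκ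
    exact hD.not_separates h₀ h₁ hsep
  · rintro ⟨C, hC, hno⟩ hrefl'
    obtain ⟨S₀, -, S₁, -, h₀, h₁, hsep⟩ := hC.exists_separates hrefl hnormal hno hκκ
    obtain ⟨α, hα, hα₀, hα₁⟩ := hrefl'.exists_lt h₀ h₁
    exact hC.not_stationary_of_separates hsep hα hα₀ hα₁
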